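/- Let $d\ge 3$, let $G$ be a finite connected simple graph with at least two vertices, and let $G(P)$ be a framework of $G$ in $\mathbb R^d$, i.e. a map $v\mapsto p_v\in\mathbb R^d$ on the vertices. Suppose that $G(P)$ is in *3D-general position*: (i) it is linearly generic, i.e. at every vertex of valence $k>1$ the $k$ emanating edges span a $(k-1)$-plane, and any $k-1$ of them span this same plane; (ii) any four distinct vertices of any cycle of $G$ span a $3$-plane. A *non-zero tensegrity* on $G(P)$ is a family of real numbers $w_{uv}=w_{vu}$ with $w_{uv}=0$ whenever $uv$ is not an edge, not all zero, such that $\sum_u w_{uv}(p_v-p_u)=0$ at every vertex $v$ of valence greater than $1$. For a cycle $(v_1,\dots,v_n)$ of $G$ ($n\ge 3$, no repeated vertices, indices modulo $n$) put $r_i=p_{v_i}$. An *associated framed cycle framework* is $\big((r_1,\dots,r_n),(e_1,\dots,e_n)\big)$ where, for every $i$, $e_i\ne r_i$ is a point of $\mathbb R^d$ lying both in $\mathrm{span}(r_{i-1},r_i,r_{i+1})$ and in the affine span of $r_i$ and the points $p_u$, $u$ running over all neighbours of $v_i$ other than $v_{i-1},v_{i+1}$. In $\mathbb{RP}^d\supset\mathbb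 R^d$, with $\vee$ and $\wedge$ the join and the intersection of projective subspaces and $ab=a\vee b$, define recursively $$e_1^{(0)}=e_1,\qquad e_3^{(0)}=e_n,$$ $$e_1^{(k)}=e_3^{(k-1)}e_1^{(k-1)}\wedge(r_{n-k}\vee r_1\vee r_2),\qquad e_3^{(k)}=e_{n-k}\,e_3^{(k-1)}\wedge(r_{n-k-1}\vee r_{n-k}\vee r_1)$$ for $1\le k\le n-3$. The recursion is *well defined* if each $e_1^{(k)}$ and each $e_3^{(k)}$, $0\le k\le n-3$, is a single point. The *join/intersection condition* of the framed cycle framework is $$r_1e_1^{(n-3)}\wedge r_2e_2\wedge r_3e_3^{(n-3)}=\mathrm{true},$$ where $\pi_1\wedge\dots\wedge\pi_m=\mathrm{true}$ means that there are projective subspaces $\pi_i'$ with $\dim\pi_i'=\dim\pi_i$ for all $i$ and $\dim(\pi_1\wedge\dots\wedge\pi_m)>\dim(\pi_1'\wedge\dots\wedge\pi_m')$, with $\dim\emptyset=-1$. Then $G(P)$ admits a non-zero tensegrity if and only if the join/intersection condition holds for every cycle of $G$ and every associated framed cycle framework along it for which the recursion is well defined. -/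

import Mathlib

/-!
# Tensegrities and join/intersection conditions

Frameworks live in `ℝ^d`, modelled by `EuclideanSpace ℝ (Fin d)`. Projective subspaces of `ℝP^d`
are represented by linear subspaces of the `(d + 1)`-dimensional space
`ℝ × EuclideanSpace ℝ (Fin d)`: a projective subspace of dimension `k` is a linear subspace of
dimension `k + 1`, and the empty set is the zero subspace. The join is `⊔`, the intersection `⊓`.
-/

namespace Tensegrity

noncomputable section

/-! ### Frameworks and self-stresses -/

section Frameworks

variable {V : Type*} [Fintype V] {d : ℕ}

/-- A stress on the edges of `G`: a symmetric assignment of real numbers (tensions), extended by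
zero to the pairs of vertices that are not joined by an edge. -/
structure IsStress (G : SimpleGraph V) (w : V → V → ℝ) : Prop where
  symm : ∀ u v, w u v = w v u
  eq_zero : ∀ u v, ¬ G.Adj u v → w u v = 0

/-- A self-stress on the framework `p`: a stress that is in equilibrium at every vertex of valence
greater than one. There is no equilibrium condition at the boundary (one-valent) vertices. -/
structure IsSelfStress (G : SimpleGraph V) [DecidableRel G.Adj]
    (p : V → EuclideanSpace ℝ (Fin d)) (w : V → V → ℝ) : Prop extends IsStress G w where
  equilibrium : ∀ v, 1 < G.degree v → ∑ u, w v u • (p v - p u) = 0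

/-- The framework `p` admits a non-zero tensegrity. -/
def AdmitsNonzeroTensegrity (G : SimpleGraph V) [DecidableRel G.Adj]
    (p : V → EuclideanSpace ℝ (Fin d)) : Prop :=
  ∃ w : V → V → ℝ, IsSelfStress G p w ∧ ∃ u v, G.Adj u v ∧ w u v ≠ 0

/-- The affine span of the edges that join `v` to the vertices of `S`. -/
def starSpan (p : V → EuclideanSpace ℝ (Fin d)) (v : V) (S : Set V) :
    AffineSubspace ℝ (EuclideanSpace ℝ (Fin d)) :=
  affineSpan ℝ (insert (p v) (p '' S))

/-- Linear genericity: at every vertex of valence `k > 1`, the `k` edges emanating from the vertex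
span a `(k - 1)`-plane, and any `k - 1` of them span this same plane. -/
def IsLinearlyGeneric (G : SimpleGraph V) [DecidableRel G.Adj]
    (p : V → EuclideanSpace ℝ (Fin d)) : Prop :=
  ∀ v, 1 < G.degree v →
    Module.finrank ℝ (starSpan p v (G.neighborSet v)).direction = G.degree v - 1 ∧
    ∀ T : Finset V, T ⊆ G.neighborFinset v → T.card = G.degree v - 1 →
      starSpan p v T = starSpan p v (G.neighborSet v)

/-- `c` is a cycle of length `n ≥ 3` in `G` without self-intersections. The index set is
`ZMod n`, so that `c_n` is `c 0`. -/
structure IsCycleIn (G : SimpleGraph V) {n : ℕ} (c : ZMod n → V) : Prop where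
  three_le : 3 ≤ n
  injective : Function.Injective c
  adj : ∀ i, G.Adj (c i) (c (i + 1))

/-- 3D-general position: linear genericity, and any four vertices of any cycle span a
three-dimensional affine subspace. -/
def InThreeDGeneralPosition (G : SimpleGraph V) [DecidableRel G.Adj]
    (p : V → EuclideanSpace ℝ (Fin d)) : Prop :=
  IsLinearlyGeneric G p ∧
  ∀ (n : ℕ) (c : ZMod n → V), IsCycleIn G c →
    ∀ s : Fin 4 → ZMod n, Function.Injective s →
      Module.finrank ℝ (affineSpan ℝ (Set.range fun j => p (c (s j)))).direction = 3

/-- `(r, e)` with `r i = p (c i)` is a framed cycle framework associated to the framework `p` along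
the cycle `c`: the boundary point `e i` is a point different from `p (c i)` that lies both in the
span of the two edges of the cycle at `c i` and in the span of all the other edges of `G` at
`c i`. -/
def IsAssociatedFraming (G : SimpleGraph V) (p : V → EuclideanSpace ℝ (Fin d))
    {n : ℕ} (c : ZMod n → V) (e : ZMod n → EuclideanSpace ℝ (Fin d)) : Prop :=
  ∀ i, e i ∈ starSpan p (c i) {c (i - 1), c (i + 1)} ∧
    e i ∈ starSpan p (c i) {u | G.Adj (c i) u ∧ u ≠ c (i - 1) ∧ u ≠ c (i + 1)} ∧
    e i ≠ p (c i)

end Frameworks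

/-! ### Join/intersection conditions -/

section JoinIntersection

variable {d : ℕ}

/-- Projective subspaces of `ℝP^d`. -/
abbrev ProjSubspace (d : ℕ) : Type := Submodule ℝ (ℝ × EuclideanSpace ℝ (Fin d))

/-- The projective point that corresponds to a point of the affine chart `ℝ^d`. -/
def pt (x : EuclideanSpace ℝ (Fin d)) : ProjSubspace d := Submodule.span ℝ {((1 : ℝ), x)}

/-- A projective subspace is a single point. -/
def IsPoint (π : ProjSubspace d) : Prop := Module.finrank ℝ π = 1

/-- The relation `π₁ ∧ ⋯ ∧ π_m = true`: there are projective subspaces of the same dimensions whose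
intersection has a smaller dimension. -/
def MeetIsTrue {m : ℕ} (π : Fin m → ProjSubspace d) : Prop :=
  ∃ π' : Fin m → ProjSubspace d,
    (∀ i, Module.finrank ℝ (π' i) = Module.finrank ℝ (π i)) ∧
    Module.finrank ℝ (⨅ i, π' i : ProjSubspace d) < Module.finrank ℝ (⨅ i, π i : ProjSubspace d)

variable {n : ℕ} (r e : ZMod n → EuclideanSpace ℝ (Fin d))

/-- The boundary point `e₃^(k)` of the last vertex `r_{n-k}` after removing the vertices
`r_n, …, r_{n-k+1}` one by one from a framed cycle. Note that `-k` is the index `n - k`. -/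
def lastBoundary : ℕ → ProjSubspace d
  | 0 => pt (e 0)
  | k + 1 => (pt (e (-(k + 1))) ⊔ lastBoundary k) ⊓
      (pt (r (-(k + 2))) ⊔ pt (r (-(k + 1))) ⊔ pt (r 1))

/-- The boundary point `e₁^(k)` of the first vertex `r₁` after removing the vertices
`r_n, …, r_{n-k+1}` one by one from a framed cycle. -/
def firstBoundary : ℕ → ProjSubspace d
  | 0 => pt (e 1)
  | k + 1 => (lastBoundary r e k ⊔ firstBoundary k) ⊓
      (pt (r (-(k + 1))) ⊔ pt (r 1) ⊔ pt (r 2))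

/-- The recursion is well defined: each of the successive intersections is a single point. -/
def RecursionDefined : Prop :=
  ∀ k ≤ n - 3, IsPoint (firstBoundary r e k) ∧ IsPoint (lastBoundary r e k)

/-- The join/intersection condition
`r₁e₁^(n-3) ∧ r₂e₂ ∧ r₃e₃^(n-3) = true` for a framed cycle framework of length `n ≥ 3`. -/
def JoinIntersectionCondition : Prop :=
  MeetIsTrue ![pt (r 1) ⊔ firstBoundary r e (n - 3), pt (r 2) ⊔ pt (e 2),
    pt (r 3) ⊔ lastBoundary r e (n - 3)]

end JoinIntersection

end

end Tensegrity

namespace Tensegrity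

/-! ### Relations among the edges at a vertex -/

section Star

variable {V : Type*} {d : ℕ}

/-! Linear genericity leaves, at each vertex `v` of valence greater than one, a single relation `lam
v` between the edge vectors up to scale, and none of its coefficients vanishes. A non-zero
tensegrity therefore amounts to non-zero scalars `α v` making `α v * lam v u` symmetric, so that the
cocycle `lam u v / lam v u` is a coboundary. On a connected graph this holds as soon as its product
along every cycle is 1 (`exists_potential`), that is, the product of the backward coefficients `lam
(c i) (c (i - 1))` equals that of the forward ones.

Along one cycle, the boundary points are `r_i + t_i (lam_{i,i-1} (r_{i-1} - r_i) + lam_{i,i+1}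
(r_{i+1} - r_i))` with `t_i ≠ 0`. Their homogeneous coordinates in `r_{i-1}, r_i, r_{i+1}` are `A_i,
Q_i, B_i`, where `A_i`, `B_i` are `t_i` times the backward and forward coefficients. The recursion
becomes an explicit elimination in such coordinates. It ends in the triangle `r₁ r₂ r₃`, where
Ceva's theorem turns concurrency into an equality of two products; after the middle coefficients of
`lastCoeff` cancel, this reads `∏ A_i = ∏ B_i` (`joinIntersectionCondition_iff_mul_eq`,
`mul_eq_iff_prod_eq`). The `t_i` cancel as well.

The cancellation needs non-zero middle coefficients. From a tensegrity to the conditions, a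
vanishing one either breaks the recursion or makes the condition automatic
(`joinIntersectionCondition_of_eq_zero`). In the converse direction, boundary points close to the
vertices avoid the problem (`exists_lastCoeff_ne_zero`). Cycles through a two-valent vertex carry no
framing, but general position forces them to be collinear triangles, for which the product identity
is automatic. -/

theorem direction_starSpan (p : V → EuclideanSpace ℝ (Fin d)) (v : V) (S : Set V) :
    (starSpan p v S).direction = Submodule.span ℝ ((fun u => p u - p v) '' S) := by
  rw [starSpan, direction_affineSpan,
    vectorSpan_eq_span_vsub_set_right ℝ (Set.mem_insert (p v) _), Set.image_insert_eq]
  simp [Set.image_image]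

theorem mem_starSpan_iff {p : V → EuclideanSpace ℝ (Fin d)} {v : V} {S : Set V}
    {x : EuclideanSpace ℝ (Fin d)} :
    x ∈ starSpan p v S ↔ x - p v ∈ Submodule.span ℝ ((fun u => p u - p v) '' S) := by
  have h : p v ∈ starSpan p v S := subset_affineSpan ℝ _ (Set.mem_insert _ _)
  rw [← direction_starSpan, ← vsub_eq_sub, AffineSubspace.vsub_right_mem_direction_iff_mem h]

theorem finrank_span_image_eq_card_iff {f : V → EuclideanSpace ℝ (Fin d)} {T : Finset V} :
    Module.finrank ℝ (Submodule.span ℝ (f '' T)) = T.card ↔ LinearIndepOn ℝ f (T : Set V) := by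
  rw [LinearIndepOn, linearIndependent_iff_card_eq_finrank_span, Set.finrank, ← Set.image_eq_range]
  simp [eq_comm]

theorem mem_span_image_finset_iff {f : V → EuclideanSpace ℝ (Fin d)} {T : Finset V}
    {x : EuclideanSpace ℝ (Fin d)} :
    x ∈ Submodule.span ℝ (f '' T) ↔ ∃ σ : V → ℝ, ∑ u ∈ T, σ u • f u = x := by
  classical
  rw [Submodule.mem_span_image_finset_iff_exists_fun]
  constructor
  · rintro ⟨σ, hσ⟩
    refine ⟨fun u => if h : u ∈ T then σ ⟨u, h⟩ else 0, ?_⟩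
    rw [← hσ, ← Finset.sum_attach]
    exact Finset.sum_congr (by simp) fun u _ => by simp
  · rintro ⟨σ, hσ⟩
    exact ⟨fun u => σ u, by rw [← hσ, ← Finset.sum_coe_sort T]⟩

variable [Fintype V] {G : SimpleGraph V} [DecidableRel G.Adj] {p : V → EuclideanSpace ℝ (Fin d)}

theorem IsLinearlyGeneric.finrank_span (hp : IsLinearlyGeneric G p) {v : V} (hv : 1 < G.degree v) :
    Module.finrank ℝ (Submodule.span ℝ ((fun u => p u - p v) '' (G.neighborFinset v : Set V))) =
      G.degree v - 1 := by
  have := (hp v hv).1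
  rw [direction_starSpan] at this
  rwa [G.coe_neighborFinset]

/-- The edges other than `u₀` number `k - 1` and span a `(k - 1)`-plane, so they are independent. -/
theorem IsLinearlyGeneric.eq_zero_of_relation (hp : IsLinearlyGeneric G p) {v : V}
    (hv : 1 < G.degree v) {μ : V → ℝ} (hμ : ∑ u ∈ G.neighborFinset v, μ u • (p u - p v) = 0)
    {u₀ : V} (hu₀ : G.Adj v u₀) (h₀ : μ u₀ = 0) {u : V} (hu : G.Adj v u) : μ u = 0 := by
  classical
  have hmem : u₀ ∈ G.neighborFinset v := by simpa using hu₀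
  have hT := (hp v hv).2 ((G.neighborFinset v).erase u₀) (Finset.erase_subset _ _)
    (by rw [Finset.card_erase_of_mem hmem, G.card_neighborFinset_eq_degree])
  have hli : LinearIndepOn ℝ (fun u => p u - p v)
      (((G.neighborFinset v).erase u₀ : Finset V) : Set V) := by
    rw [← finrank_span_image_eq_card_iff, ← direction_starSpan, hT, (hp v hv).1,
      Finset.card_erase_of_mem hmem, G.card_neighborFinset_eq_degree]
  rw [linearIndepOn_finset_iff] at hli
  by_cases h : u = u₀
  · rw [h, h₀]
  · refine hli μ ?_ u (by simpa [h] using hu)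
    rw [← Finset.add_sum_erase _ _ hmem, h₀, zero_smul, zero_add] at hμ
    exact hμ

theorem IsLinearlyGeneric.exists_relation (hp : IsLinearlyGeneric G p) {v : V}
    (hv : 1 < G.degree v) :
    ∃ μ : V → ℝ, (∀ u, G.Adj v u → μ u ≠ 0) ∧
      ∑ u ∈ G.neighborFinset v, μ u • (p u - p v) = 0 := by
  have hli : ¬ LinearIndepOn ℝ (fun u => p u - p v) (G.neighborFinset v : Set V) := by
    rw [← finrank_span_image_eq_card_iff, hp.finrank_span hv, G.card_neighborFinset_eq_degree]
    omega
  rw [linearIndepOn_finset_iff] at hli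
  push Not at hli
  obtain ⟨μ, hμ, i, hi, hne⟩ := hli
  exact ⟨μ, fun u hu h0 => hne (hp.eq_zero_of_relation hv hμ hu h0 (by simpa using hi)), hμ⟩

/-- Any two relations at a vertex are proportional. -/
theorem IsLinearlyGeneric.relation_eq_smul (hp : IsLinearlyGeneric G p) {v : V}
    (hv : 1 < G.degree v) {lam μ : V → ℝ} (hlam : ∀ u, G.Adj v u → lam u ≠ 0)
    (hlam0 : ∑ u ∈ G.neighborFinset v, lam u • (p u - p v) = 0)
    (hμ : ∑ u ∈ G.neighborFinset v, μ u • (p u - p v) = 0) :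
    ∃ t : ℝ, ∀ u, G.Adj v u → μ u = t * lam u := by
  obtain ⟨u₀, hu₀⟩ : (G.neighborFinset v).Nonempty := by
    rw [← Finset.card_pos, G.card_neighborFinset_eq_degree]; omega
  have hu₀ : G.Adj v u₀ := by simpa using hu₀
  refine ⟨μ u₀ / lam u₀, fun u hu => ?_⟩
  have := hp.eq_zero_of_relation hv (μ := fun u => μ u - μ u₀ / lam u₀ * lam u) (by
    simp only [sub_smul, Finset.sum_sub_distrib, mul_smul, ← Finset.smul_sum, hlam0, hμ]
    simp) hu₀ (by simp [div_mul_cancel₀ _ (hlam u₀ hu₀)]) hu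
  linarith

theorem sum_neighborFinset_eq [DecidableEq V] {M : Type*} [AddCommMonoid M] {v a b : V}
    (ha : G.Adj v a) (hb : G.Adj v b) (hab : a ≠ b) (f : V → M) :
    ∑ u ∈ G.neighborFinset v, f u =
      f a + f b + ∑ u ∈ (G.neighborFinset v).filter (fun u => u ≠ a ∧ u ≠ b), f u := by
  rw [← Finset.sum_filter_add_sum_filter_not (G.neighborFinset v) (fun u => ¬ (u ≠ a ∧ u ≠ b)),
    ← Finset.sum_pair hab]
  congr 1
  · refine Finset.sum_congr ?_ fun _ _ => rfl
    ext u
    simp only [Finset.mem_filter, SimpleGraph.mem_neighborFinset, Finset.mem_insert,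
      Finset.mem_singleton]
    grind
  · simp

theorem one_lt_degree_of_adj {v a b : V} (ha : G.Adj v a) (hb : G.Adj v b) (hab : a ≠ b) :
    1 < G.degree v := by
  rw [← G.card_neighborFinset_eq_degree, Finset.one_lt_card]
  exact ⟨a, by simpa using ha, b, by simpa using hb, hab⟩

/-- The two edges at a vertex are independent as soon as there is a third one. -/
theorem IsLinearlyGeneric.pair_independent (hp : IsLinearlyGeneric G p) {v a b c : V}
    (ha : G.Adj v a) (hb : G.Adj v b) (hab : a ≠ b) (hc : G.Adj v c) (hca : c ≠ a) (hcb : c ≠ b)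
    {s t : ℝ} (h : s • (p a - p v) + t • (p b - p v) = 0) : s = 0 ∧ t = 0 := by
  classical
  have key : ∀ u, G.Adj v u → (if u = a then s else if u = b then t else 0) = 0 := by
    intro u hu
    refine hp.eq_zero_of_relation (one_lt_degree_of_adj ha hb hab)
      (μ := fun u => if u = a then s else if u = b then t else 0) ?_ hc (by simp [hca, hcb]) hu
    rw [sum_neighborFinset_eq ha hb hab, Finset.sum_eq_zero]
    · simpa [hab.symm] using h
    · intro u hu
      simp only [Finset.mem_filter] at hu
      simp [hu.2.1, hu.2.2]
  exact ⟨by simpa using key a ha, by simpa [hab.symm] using key b hb⟩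

/-- The boundary points at a vertex lie on the line determined by the relation at the vertex. -/
theorem IsLinearlyGeneric.exists_of_mem_inter (hp : IsLinearlyGeneric G p) {v a b : V}
    (ha : G.Adj v a) (hb : G.Adj v b) (hab : a ≠ b) {lam : V → ℝ}
    (hlam : ∀ u, G.Adj v u → lam u ≠ 0)
    (hlam0 : ∑ u ∈ G.neighborFinset v, lam u • (p u - p v) = 0) {x : EuclideanSpace ℝ (Fin d)}
    (h₁ : x ∈ starSpan p v {a, b}) (h₂ : x ∈ starSpan p v {u | G.Adj v u ∧ u ≠ a ∧ u ≠ b})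
    (hx : x ≠ p v) :
    (∃ t : ℝ, t ≠ 0 ∧ x - p v = (t * lam a) • (p a - p v) + (t * lam b) • (p b - p v)) ∧
      ∃ c, G.Adj v c ∧ c ≠ a ∧ c ≠ b := by
  classical
  rw [mem_starSpan_iff] at h₁ h₂
  rw [Set.image_pair, Submodule.mem_span_pair] at h₁
  obtain ⟨s, t, hst⟩ := h₁
  have hset : {u | G.Adj v u ∧ u ≠ a ∧ u ≠ b} =
      (((G.neighborFinset v).filter (fun u => u ≠ a ∧ u ≠ b) : Finset V) : Set V) := by
    ext u; simp
  constructor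
  · rw [hset, mem_span_image_finset_iff] at h₂
    obtain ⟨σ, hσ⟩ := h₂
    -- The difference of the two expressions for `x - p v` is a relation at `v`, hence a multiple of
    -- `lam`.
    obtain ⟨τ, hτ⟩ := hp.relation_eq_smul (one_lt_degree_of_adj ha hb hab) hlam hlam0
      (μ := fun u => if u = a then s else if u = b then t else - σ u) (by
        rw [sum_neighborFinset_eq ha hb hab,
          Finset.sum_congr rfl (g := fun u => - (σ u • (p u - p v))), Finset.sum_neg_distrib, hσ]
        · simp [hab.symm, hst]
        · intro u hu
          simp only [Finset.mem_filter] at hu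
          simp only [hu.2.1, hu.2.2, if_false]
          simp)
    have h1 : s = τ * lam a := by simpa using hτ a ha
    have h2 : t = τ * lam b := by simpa [hab.symm] using hτ b hb
    refine ⟨τ, ?_, by rw [← hst, h1, h2]⟩
    rintro rfl
    apply hx
    rw [← sub_eq_zero, ← hst, h1, h2]
    simp
  · by_contra! hno
    have : {u | G.Adj v u ∧ u ≠ a ∧ u ≠ b} = ∅ := by
      ext u
      simp only [Set.mem_ofPred_eq, Set.mem_empty_iff_false, iff_false, not_and, not_not]
      exact fun h => hno u h
    rw [this] at h₂
    simp [sub_eq_zero, hx] at h₂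

/-- The points on the line determined by the relation are boundary points. -/
theorem mem_starSpan_of_relation {v a b : V}
    (ha : G.Adj v a) (hb : G.Adj v b) (hab : a ≠ b) {lam : V → ℝ}
    (hlam0 : ∑ u ∈ G.neighborFinset v, lam u • (p u - p v) = 0) {x : EuclideanSpace ℝ (Fin d)}
    {t : ℝ} (hx : x - p v = (t * lam a) • (p a - p v) + (t * lam b) • (p b - p v)) :
    x ∈ starSpan p v {a, b} ∧ x ∈ starSpan p v {u | G.Adj v u ∧ u ≠ a ∧ u ≠ b} := by
  classical
  rw [mem_starSpan_iff, mem_starSpan_iff]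
  constructor
  · rw [hx, Set.image_pair, Submodule.mem_span_pair]
    exact ⟨_, _, rfl⟩
  · rw [sum_neighborFinset_eq ha hb hab, add_eq_zero_iff_eq_neg] at hlam0
    rw [hx, mul_smul, mul_smul, ← smul_add, hlam0]
    refine Submodule.smul_mem _ _ (Submodule.neg_mem _ (Submodule.sum_mem _ fun u hu => ?_))
    refine Submodule.smul_mem _ _ (Submodule.subset_span ⟨u, ?_, rfl⟩)
    simpa using hu

end Star

/-! ### Multiplicative cocycles on a connected graph -/

section Potential

variable {V : Type*} {G : SimpleGraph V}

/-- The product of `g` along a walk. -/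
def holonomy (g : V → V → ℝ) : ∀ {u v : V}, G.Walk u v → ℝ
  | _, _, .nil => 1
  | u, _, .cons (v := v) _ q => g u v * holonomy g q

theorem holonomy_append (g : V → V → ℝ) {u v w : V} (q : G.Walk u v) (q' : G.Walk v w) :
    holonomy g (q.append q') = holonomy g q * holonomy g q' := by
  induction q with
  | nil => simp [holonomy]
  | cons h q ih => simp [holonomy, ih, mul_assoc]

theorem holonomy_eq_prod (g : V → V → ℝ) {u v : V} (q : G.Walk u v) :
    holonomy g q = ∏ i ∈ Finset.range q.length, g (q.getVert i) (q.getVert (i + 1)) := by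
  induction q with
  | nil => simp [holonomy]
  | cons h q ih =>
    rw [holonomy, ih, SimpleGraph.Walk.length_cons, Finset.prod_range_succ']
    simp [mul_comm]

theorem prod_zmod_eq_prod_range (n : ℕ) [NeZero n] (f : ZMod n → ℝ) :
    ∏ i ∈ Finset.range n, f i = ∏ i : ZMod n, f i := by
  refine Finset.prod_bij (fun i _ => (i : ZMod n)) (by simp) ?_ ?_ (by simp)
  · intro i hi j hj h
    simp only [Finset.mem_range] at hi hj
    rw [ZMod.natCast_eq_natCast_iff', Nat.mod_eq_of_lt hi, Nat.mod_eq_of_lt hj] at h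
    exact h
  · intro b _
    exact ⟨b.val, by simpa using b.val_lt, by simp⟩

/-- A path of length at least two whose ends are adjacent closes up to a cycle. -/
theorem exists_isCycleIn_of_isPath {u v : V} (h : G.Adj u v) {q : G.Walk v u} (hq : q.IsPath)
    (hlen : 2 ≤ q.length) (g : V → V → ℝ) :
    ∃ c : ZMod (q.length + 1) → V, IsCycleIn G c ∧
      ∏ i, g (c i) (c (i + 1)) = g u v * holonomy g q := by
  set n := q.length + 1 with hn
  have hval : ∀ j, j < n → ((j : ℕ) : ZMod n).val = j := fun j hj => ZMod.val_cast_of_lt hj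
  have hcast : ∀ i : ZMod n, ∃ j, j < n ∧ i = (j : ZMod n) :=
    fun i => ⟨i.val, i.val_lt, by simp⟩
  have hlast : ((q.length : ZMod n) + 1) = 0 := by
    have := ZMod.natCast_self n
    rwa [hn, Nat.cast_add, Nat.cast_one] at this
  have hsucc : ∀ j, j < q.length → q.getVert (((j : ZMod n) + 1).val) = q.getVert (j + 1) := by
    intro j hj
    have : ((j : ZMod n) + 1) = ((j + 1 : ℕ) : ZMod n) := by simp
    rw [this, hval _ (by omega)]
  refine ⟨fun i => q.getVert i.val, ⟨by omega, ?_, ?_⟩, ?_⟩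
  · intro i j hij
    obtain ⟨a, ha, rfl⟩ := hcast i
    obtain ⟨b, hb, rfl⟩ := hcast j
    simp only [hval a ha, hval b hb] at hij
    rw [hq.getVert_injOn (by simp; omega) (by simp; omega) hij]
  · intro i
    obtain ⟨j, hj, rfl⟩ := hcast i
    simp only [hval j hj]
    rcases Nat.lt_or_ge j q.length with hj' | hj'
    · rw [hsucc j hj']
      exact q.adj_getVert_succ hj'
    · obtain rfl : j = q.length := by omega
      rw [hlast]
      simpa using h
  · rw [← prod_zmod_eq_prod_range, Finset.prod_range_succ, holonomy_eq_prod, mul_comm]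
    simp only [hlast, hval _ (Nat.lt_succ_self q.length)]
    congr 1
    · simp
    · refine Finset.prod_congr rfl fun j hj => ?_
      simp only [Finset.mem_range] at hj
      rw [hval j (by omega), hsucc j hj]

/-- An edge closed up by a path either runs back along itself or bounds a genuine cycle. -/
theorem mul_holonomy_eq_one {g : V → V → ℝ} (hg : ∀ u v, G.Adj u v → g u v * g v u = 1)
    (hcyc : ∀ (n : ℕ) [NeZero n] (c : ZMod n → V), IsCycleIn G c →
      ∏ i, g (c i) (c (i + 1)) = 1)
    {u v : V} (h : G.Adj u v) {q : G.Walk v u} (hq : q.IsPath) : g u v * holonomy g q = 1 := by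
  rcases Nat.lt_or_ge q.length 2 with hlen | hlen
  · cases q with
    | nil => exact absurd h (G.irrefl)
    | cons h' q' =>
      simp only [SimpleGraph.Walk.length_cons] at hlen
      cases q' with
      | nil => simpa [holonomy] using hg _ _ h
      | cons _ _ => simp at hlen
  · obtain ⟨c, hc, hprod⟩ := exists_isCycleIn_of_isPath h hq hlen g
    rw [← hprod, hcyc _ c hc]

/-- Each loop cut out by `bypass` is an edge followed by a path back to its start, and so
contributes the factor 1. Closed walks then have trivial holonomy. -/
theorem holonomy_bypass [DecidableEq V] {g : V → V → ℝ}
    (hg : ∀ u v, G.Adj u v → g u v * g v u = 1)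
    (hcyc : ∀ (n : ℕ) [NeZero n] (c : ZMod n → V), IsCycleIn G c →
      ∏ i, g (c i) (c (i + 1)) = 1)
    {u v : V} (q : G.Walk u v) : holonomy g q = holonomy g q.bypass := by
  induction q with
  | nil => rfl
  | @cons a b c h q ih =>
    rw [holonomy, ih, SimpleGraph.Walk.bypass]
    split_ifs with hs
    · conv_lhs => rw [← q.bypass.take_spec hs]
      rw [holonomy_append, ← mul_assoc,
        mul_holonomy_eq_one hg hcyc h (q.bypass_isPath.takeUntil hs), one_mul]
    · rfl

/-- A multiplicative cocycle with trivial holonomy along the cycles is a coboundary. -/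
theorem exists_potential (hG : G.Connected) {g : V → V → ℝ}
    (hg : ∀ u v, G.Adj u v → g u v * g v u = 1)
    (hcyc : ∀ (n : ℕ) [NeZero n] (c : ZMod n → V), IsCycleIn G c →
      ∏ i, g (c i) (c (i + 1)) = 1) :
    ∃ α : V → ℝ, (∀ v, α v ≠ 0) ∧ ∀ u v, G.Adj u v → α v = α u * g u v := by
  classical
  have hclosed : ∀ v (q : G.Walk v v), holonomy g q = 1 := by
    intro v q
    rw [holonomy_bypass hg hcyc, (SimpleGraph.Walk.isPath_iff_nil.mp q.bypass_isPath).eq_nil]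
    rfl
  obtain ⟨o⟩ := hG.nonempty
  choose q hq using fun v => (⟨(hG.preconnected o v).some, trivial⟩ : ∃ _ : G.Walk o v, True)
  choose q' hq' using fun v => (⟨(hG.preconnected v o).some, trivial⟩ : ∃ _ : G.Walk v o, True)
  have hne : ∀ v, holonomy g (q v) * holonomy g (q' v) = 1 := fun v => by
    rw [← holonomy_append, hclosed]
  refine ⟨fun v => holonomy g (q v), fun v => left_ne_zero_of_mul_eq_one (hne v), ?_⟩
  intro u v h
  have h1 := hclosed o ((q u).append (.cons h (q' v)))
  rw [holonomy_append, holonomy, ← mul_assoc] at h1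
  exact mul_right_cancel₀ (right_ne_zero_of_mul_eq_one (hne v)) ((hne v).trans h1.symm)

end Potential

/-! ### Generic intersections and elimination -/

section LinearAlgebra

open Module

theorem exists_finrank_eq_inf_eq_bot {M : Type*} [AddCommGroup M] [Module ℝ M]
    [FiniteDimensional ℝ M] (P : Submodule ℝ M) {m : ℕ} (h : finrank ℝ P + m ≤ finrank ℝ M) :
    ∃ P' : Submodule ℝ M, finrank ℝ P' = m ∧ P ⊓ P' = ⊥ := by
  obtain ⟨C, hC⟩ := Submodule.exists_isCompl P
  have hdim := Submodule.finrank_add_eq_of_isCompl hC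
  obtain ⟨f, hf⟩ := exists_linearIndependent_of_le_finrank (R := ℝ) (M := C) (n := m) (by omega)
  refine ⟨(Submodule.span ℝ (Set.range f)).map C.subtype, ?_, ?_⟩
  · rw [Submodule.finrank_map_subtype_eq, finrank_span_eq_card hf, Fintype.card_fin]
  · exact eq_bot_iff.2 ((inf_le_inf_left P (Submodule.map_subtype_le C _)).trans_eq
      hC.inf_eq_bot)

/-- Since `2 + 2 ≤ d + 1`, two lines in general position in `ℝP^d` are disjoint, so the least
possible intersection is empty and the condition is plain concurrency. -/
theorem meetIsTrue_iff {d : ℕ} (hd : 3 ≤ d) {π : Fin 3 → ProjSubspace d}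
    (h₀ : finrank ℝ (π 0) ≤ 2) (h₁ : finrank ℝ (π 1) ≤ 2) :
    MeetIsTrue π ↔ ∃ x ≠ 0, x ∈ π 0 ∧ x ∈ π 1 ∧ x ∈ π 2 := by
  have hex : (∃ x ≠ 0, x ∈ π 0 ∧ x ∈ π 1 ∧ x ∈ π 2) ↔ (⨅ i, π i) ≠ ⊥ := by
    rw [Submodule.ne_bot_iff]
    simp only [Submodule.mem_iInf, Fin.forall_fin_succ, IsEmpty.forall_iff, and_true]
    constructor
    · rintro ⟨x, hx, h⟩; exact ⟨x, h, hx⟩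
    · rintro ⟨x, h, hx⟩; exact ⟨x, hx, h⟩
  rw [hex]
  constructor
  · rintro ⟨π', -, h⟩ h0
    rw [h0, finrank_bot] at h
    omega
  · intro h
    obtain ⟨P, hP, hbot⟩ := exists_finrank_eq_inf_eq_bot (π 0) (m := finrank ℝ (π 1)) (by
      simp only [finrank_prod, finrank_self, finrank_euclideanSpace, Fintype.card_fin]; omega)
    refine ⟨![π 0, P, π 2], fun i => ?_, ?_⟩
    · fin_cases i
      · rfl
      · exact hP
      · rfl
    · have : (⨅ i, ![π 0, P, π 2] i) = ⊥ := by
        rw [eq_bot_iff, ← hbot]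
        exact le_inf (iInf_le _ 0) (iInf_le _ 1)
      rw [this, finrank_bot]
      exact Nat.pos_of_ne_zero fun h' => h (Submodule.finrank_eq_zero.1 h')

/-- The intersection of a line, spanned by two points, with a hyperplane that does not contain it. -/
theorem span_sup_span_inf_eq {M : Type*} [AddCommGroup M] [Module ℝ M] {P : Submodule ℝ M}
    {D X Y : M} (hD : D ∉ P) {s t : ℝ} (hX : X - s • D ∈ P) (hY : Y - t • D ∈ P)
    (h : s ≠ 0 ∨ t ≠ 0) :
    (Submodule.span ℝ {X} ⊔ Submodule.span ℝ {Y}) ⊓ P = Submodule.span ℝ {s • Y - t • X} := by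
  apply le_antisymm
  · rintro z ⟨hz, hzP⟩
    rw [SetLike.mem_coe, Submodule.mem_sup] at hz
    obtain ⟨y₁, hy₁, y₂, hy₂, rfl⟩ := hz
    obtain ⟨a, rfl⟩ := Submodule.mem_span_singleton.1 hy₁
    obtain ⟨b, rfl⟩ := Submodule.mem_span_singleton.1 hy₂
    have hmem : (a * s + b * t) • D ∈ P := by
      have := P.sub_mem hzP (P.add_mem (P.smul_mem a hX) (P.smul_mem b hY))
      convert this using 1
      module
    have h0 : a * s + b * t = 0 := by
      by_contra hne
      exact hD ((P.smul_mem_iff hne).1 hmem)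
    rw [Submodule.mem_span_singleton]
    rcases h with hs | ht
    · refine ⟨b / s, ?_⟩
      obtain rfl : a = - (b * t) / s := by field_simp; linarith
      match_scalars <;> field_simp
    · refine ⟨- a / t, ?_⟩
      obtain rfl : b = - (a * s) / t := by field_simp; linarith
      match_scalars <;> field_simp
  · rw [Submodule.span_singleton_le_iff_mem]
    refine ⟨Submodule.sub_mem _ ?_ ?_, ?_⟩
    · exact Submodule.smul_mem _ _ (Submodule.mem_sup_right (Submodule.mem_span_singleton_self _))
    · exact Submodule.smul_mem _ _ (Submodule.mem_sup_left (Submodule.mem_span_singleton_self _))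
    · have := P.sub_mem (P.smul_mem s hY) (P.smul_mem t hX)
      rw [SetLike.mem_coe]
      convert this using 1
      module

theorem finrank_span_sup_span_le {M : Type*} [AddCommGroup M] [Module ℝ M]
    [FiniteDimensional ℝ M] (X Y : M) :
    finrank ℝ (Submodule.span ℝ {X} ⊔ Submodule.span ℝ {Y} : Submodule ℝ M) ≤ 2 :=
  (Submodule.finrank_add_le_finrank_add_finrank _ _).trans
    (by
      simpa using add_le_add (finrank_span_le_card (R := ℝ) ({X} : Set M))
        (finrank_span_le_card (R := ℝ) ({Y} : Set M)))

theorem coeff_eq_zero_of_three {M : Type*} [AddCommGroup M] [Module ℝ M] {x y z : M}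
    (h : LinearIndependent ℝ ![x, y, z]) {a b c : ℝ} (h0 : a • x + b • y + c • z = 0) :
    a = 0 ∧ b = 0 ∧ c = 0 := by
  have := Fintype.linearIndependent_iff.1 h ![a, b, c] (by
    simpa [Fin.sum_univ_succ, add_assoc] using h0)
  exact ⟨this 0, this 1, this 2⟩

theorem coeff_eq_zero_of_four {M : Type*} [AddCommGroup M] [Module ℝ M] {x y z w : M}
    (h : LinearIndependent ℝ ![x, y, z, w]) {a b c d : ℝ}
    (h0 : a • x + b • y + c • z + d • w = 0) : a = 0 ∧ b = 0 ∧ c = 0 ∧ d = 0 := by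
  have := Fintype.linearIndependent_iff.1 h ![a, b, c, d] (by
    simpa [Fin.sum_univ_succ, add_assoc] using h0)
  exact ⟨this 0, this 1, this 2, this 3⟩

theorem mem_span_sup_span_iff {M : Type*} [AddCommGroup M] [Module ℝ M] {x y z : M} :
    z ∈ Submodule.span ℝ {x} ⊔ Submodule.span ℝ {y} ↔ ∃ a b : ℝ, a • x + b • y = z := by
  rw [← Submodule.mem_span_pair, Submodule.span_insert]

end LinearAlgebra

/-! ### Homogeneous coordinates and cyclic indices -/

section Homogeneous

variable {d n : ℕ}

/-- The vector of homogeneous coordinates of a point of the affine chart. -/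
def homVec (x : EuclideanSpace ℝ (Fin d)) : ℝ × EuclideanSpace ℝ (Fin d) := (1, x)

theorem pt_eq (x : EuclideanSpace ℝ (Fin d)) : pt x = Submodule.span ℝ {homVec x} := rfl

theorem homVec_mem_pt (x : EuclideanSpace ℝ (Fin d)) : homVec x ∈ pt x :=
  Submodule.mem_span_singleton_self _

theorem notMem_sup_pt {x y z w : EuclideanSpace ℝ (Fin d)}
    (h : LinearIndependent ℝ ![homVec x, homVec y, homVec z, homVec w]) :
    homVec w ∉ pt x ⊔ pt y ⊔ pt z := by
  intro hw
  simp only [pt_eq, Submodule.mem_sup, Submodule.mem_span_singleton] at hw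
  obtain ⟨_, ⟨_, ⟨a, rfl⟩, _, ⟨b, rfl⟩, rfl⟩, _, ⟨c, rfl⟩, h'⟩ := hw
  have := (coeff_eq_zero_of_four h (a := a) (b := b) (c := c) (d := -1) (by
    rw [h', neg_smul, one_smul, add_neg_cancel])).2.2.2
  norm_num at this

theorem injective_natCast_sub {m : Fin 4 → ℕ} (hm : Function.Injective m) (hlt : ∀ j, m j < n)
    (c : ZMod n) : Function.Injective fun j => (m j : ZMod n) - c := by
  intro i j hij
  have h : (m i : ZMod n) = m j := sub_left_injective hij
  rw [ZMod.natCast_eq_natCast_iff', Nat.mod_eq_of_lt (hlt i), Nat.mod_eq_of_lt (hlt j)] at h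
  exact hm h

/-- The substitution `i ↦ 2 - i` lists the final triangle first, with 0 standing for its third
vertex, and then the remaining indices in the order in which the recursion uses them. -/
theorem prod_zmod_eq (m : ℕ) (hn : n = m + 3) [NeZero n] (f : ZMod n → ℝ) :
    ∏ i, f i = f 0 * f 1 * f 2 * ∏ j ∈ Finset.range m, f (-(j + 1)) := by
  rw [← (Equiv.subLeft (2 : ZMod n)).prod_comp, ← prod_zmod_eq_prod_range]
  rw [show Finset.range n = Finset.range (m + 3) by rw [hn], Finset.prod_range_succ',
    Finset.prod_range_succ', Finset.prod_range_succ']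
  simp only [Equiv.subLeft_apply]
  have h0 : (2 : ZMod n) - ((0 + 1 + 1 : ℕ) : ZMod n) = 0 := by push_cast; ring
  have h1 : (2 : ZMod n) - ((0 + 1 : ℕ) : ZMod n) = 1 := by push_cast; ring
  have h2 : (2 : ZMod n) - ((0 : ℕ) : ZMod n) = 2 := by push_cast; ring
  have h3 : ∀ j : ℕ, (2 : ZMod n) - ((j + 1 + 1 + 1 : ℕ) : ZMod n) = -(j + 1) := by
    intro j; push_cast; ring
  rw [h0, h1, h2]
  simp only [h3]
  ring

end Homogeneous

/-! ### The recursion in coordinates -/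

section Recursion

variable {d n : ℕ}

/-- The homogeneous coordinates of `e₃^(k)` with respect to `r_{n-k-1}`, `r_{n-k}`, `r₁`. -/
def lastCoeff (A Q B : ZMod n → ℝ) : ℕ → ℝ × ℝ × ℝ
  | 0 => (A 0, Q 0, B 0)
  | k + 1 =>
    (-(lastCoeff A Q B k).2.1 * A (-(k + 1)),
      B (-(k + 1)) * (lastCoeff A Q B k).1 - (lastCoeff A Q B k).2.1 * Q (-(k + 1)),
      B (-(k + 1)) * (lastCoeff A Q B k).2.2)

/-- The homogeneous coordinates of `e₁^(k)` with respect to `r_{n-k}`, `r₁`, `r₂`. -/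
def firstCoeff (A Q B : ZMod n → ℝ) : ℕ → ℝ × ℝ × ℝ
  | 0 => (A 1, Q 1, B 1)
  | k + 1 =>
    ((firstCoeff A Q B k).1 * (lastCoeff A Q B k).1,
      (firstCoeff A Q B k).1 * (lastCoeff A Q B k).2.2 -
        (lastCoeff A Q B k).2.1 * (firstCoeff A Q B k).2.1,
      -(lastCoeff A Q B k).2.1 * (firstCoeff A Q B k).2.2)

/-- The vector of homogeneous coordinates of `e₃^(k)`. -/
def lastVec (r : ZMod n → EuclideanSpace ℝ (Fin d)) (A Q B : ZMod n → ℝ) (k : ℕ) :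
    ℝ × EuclideanSpace ℝ (Fin d) :=
  (lastCoeff A Q B k).1 • homVec (r (-(k + 1))) + (lastCoeff A Q B k).2.1 • homVec (r (-k)) +
    (lastCoeff A Q B k).2.2 • homVec (r 1)

/-- The vector of homogeneous coordinates of `e₁^(k)`. -/
def firstVec (r : ZMod n → EuclideanSpace ℝ (Fin d)) (A Q B : ZMod n → ℝ) (k : ℕ) :
    ℝ × EuclideanSpace ℝ (Fin d) :=
  (firstCoeff A Q B k).1 • homVec (r (-k)) + (firstCoeff A Q B k).2.1 • homVec (r 1) +
    (firstCoeff A Q B k).2.2 • homVec (r 2)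

/-- A framed cycle in general position, the boundary points being given by their homogeneous
coordinates. -/
structure IsFramedCycle (r e : ZMod n → EuclideanSpace ℝ (Fin d)) (A Q B : ZMod n → ℝ) :
    Prop where
  three_le : 3 ≤ n
  eq : ∀ i, homVec (e i) =
    A i • homVec (r (i - 1)) + Q i • homVec (r i) + B i • homVec (r (i + 1))
  left_ne_zero : ∀ i, A i ≠ 0
  right_ne_zero : ∀ i, B i ≠ 0
  independent_three : LinearIndependent ℝ ![homVec (r 1), homVec (r 2), homVec (r 3)]
  independent_four : ∀ i j k l, Function.Injective ![i, j, k, l] →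
    LinearIndependent ℝ ![homVec (r i), homVec (r j), homVec (r k), homVec (r l)]

namespace IsFramedCycle

variable {r e : ZMod n → EuclideanSpace ℝ (Fin d)} {A Q B : ZMod n → ℝ}

theorem injective_last (h : IsFramedCycle r e A Q B) {k : ℕ} (hk : k + 1 ≤ n - 3) :
    Function.Injective ![(-(k + 2) : ZMod n), -(k + 1), 1, -k] := by
  -- Offsets from the index `-(k + 2)`; the largest, `k + 3`, is below `n` exactly because `k + 1 ≤
  -- n - 3`.
  convert injective_natCast_sub (n := n) (m := ![0, 1, k + 3, 2]) ?_ ?_ ((k : ZMod n) + 2) using 1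
  · funext j
    fin_cases j <;> simp <;> ring
  · intro i j
    fin_cases i <;> fin_cases j <;> simp
  · have := h.three_le
    intro j
    fin_cases j <;> simp <;> omega

theorem injective_first (h : IsFramedCycle r e A Q B) {k : ℕ} (hk : k + 1 ≤ n - 3) :
    Function.Injective ![(-(k + 1) : ZMod n), 1, 2, -k] := by
  convert injective_natCast_sub (n := n) (m := ![0, k + 2, k + 3, 1]) ?_ ?_ ((k : ZMod n) + 1)
    using 1
  · funext j
    fin_cases j <;> simp <;> ring
  · intro i j
    fin_cases i <;> fin_cases j <;> simp
  · have := h.three_le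
    intro j
    fin_cases j <;> simp <;> omega

theorem notMem_last (h : IsFramedCycle r e A Q B) {k : ℕ} (hk : k + 1 ≤ n - 3) :
    homVec (r (-k)) ∉ pt (r (-(k + 2))) ⊔ pt (r (-(k + 1))) ⊔ pt (r 1) :=
  notMem_sup_pt (h.independent_four _ _ _ _ (h.injective_last hk))

theorem notMem_first (h : IsFramedCycle r e A Q B) {k : ℕ} (hk : k + 1 ≤ n - 3) :
    homVec (r (-k)) ∉ pt (r (-(k + 1))) ⊔ pt (r 1) ⊔ pt (r 2) :=
  notMem_sup_pt (h.independent_four _ _ _ _ (h.injective_first hk))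

/-- Each step eliminates `r_{n-k}` between `e_{n-k-1}` and `e₃^(k)`. Its coefficient in the former
is some `B i ≠ 0`, so the formula never degenerates. -/
theorem lastBoundary_eq (h : IsFramedCycle r e A Q B) {k : ℕ} (hk : k ≤ n - 3) :
    lastBoundary r e k = Submodule.span ℝ {lastVec r A Q B k} := by
  induction k with
  | zero =>
    rw [lastBoundary, pt_eq, h.eq, lastVec]
    simp [lastCoeff]
  | succ k ih =>
    have e1 : (-((k : ZMod n) + 1) - 1) = -(k + 2) := by ring
    have e2 : (-((k : ZMod n) + 1) + 1) = -k := by ring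
    have he := h.eq (-(k + 1))
    rw [e1, e2] at he
    have m1 : homVec (r (-((k : ZMod n) + 2))) ∈
        pt (r (-(k + 2))) ⊔ pt (r (-(k + 1))) ⊔ pt (r 1) :=
      Submodule.mem_sup_left (Submodule.mem_sup_left (homVec_mem_pt _))
    have m2 : homVec (r (-((k : ZMod n) + 1))) ∈
        pt (r (-(k + 2))) ⊔ pt (r (-(k + 1))) ⊔ pt (r 1) :=
      Submodule.mem_sup_left (Submodule.mem_sup_right (homVec_mem_pt _))
    have m3 : homVec (r 1) ∈ pt (r (-((k : ZMod n) + 2))) ⊔ pt (r (-(k + 1))) ⊔ pt (r 1) :=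
      Submodule.mem_sup_right (homVec_mem_pt _)
    rw [lastBoundary, ih (by omega), pt_eq (e _),
      span_sup_span_inf_eq (h.notMem_last hk) (s := B (-(k + 1))) (t := (lastCoeff A Q B k).2.1)
        _ _ (Or.inl (h.right_ne_zero _))]
    · have e3 : (-((k : ZMod n) + 1 + 1)) = -(k + 2) := by ring
      congr 2
      rw [he, lastVec, lastVec]
      push_cast
      rw [e3, lastCoeff]
      module
    · rw [he, add_sub_cancel_right]
      exact Submodule.add_mem _ (Submodule.smul_mem _ _ m1) (Submodule.smul_mem _ _ m2)
    · rw [lastVec, add_right_comm, add_sub_cancel_right]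
      exact Submodule.add_mem _ (Submodule.smul_mem _ _ m2) (Submodule.smul_mem _ _ m3)

/-- Here `r_{n-k}` is eliminated between `e₁^(k)` and `e₃^(k)`; `hne` says that these do not both
lie in the intersecting plane. -/
theorem firstBoundary_succ_eq (h : IsFramedCycle r e A Q B) {k : ℕ} (hk : k + 1 ≤ n - 3)
    (hF : firstBoundary r e k = Submodule.span ℝ {firstVec r A Q B k})
    (hne : (firstCoeff A Q B k).1 ≠ 0 ∨ (lastCoeff A Q B k).2.1 ≠ 0) :
    firstBoundary r e (k + 1) = Submodule.span ℝ {firstVec r A Q B (k + 1)} := by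
  have m1 : homVec (r (-((k : ZMod n) + 1))) ∈ pt (r (-(k + 1))) ⊔ pt (r 1) ⊔ pt (r 2) :=
    Submodule.mem_sup_left (Submodule.mem_sup_left (homVec_mem_pt _))
  have m2 : homVec (r 1) ∈ pt (r (-((k : ZMod n) + 1))) ⊔ pt (r 1) ⊔ pt (r 2) :=
    Submodule.mem_sup_left (Submodule.mem_sup_right (homVec_mem_pt _))
  have m3 : homVec (r 2) ∈ pt (r (-((k : ZMod n) + 1))) ⊔ pt (r 1) ⊔ pt (r 2) :=
    Submodule.mem_sup_right (homVec_mem_pt _)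
  rw [firstBoundary, hF, h.lastBoundary_eq (by omega), sup_comm,
    span_sup_span_inf_eq (h.notMem_first hk) (s := (firstCoeff A Q B k).1)
      (t := (lastCoeff A Q B k).2.1) _ _ hne]
  · congr 2
    rw [lastVec, firstVec, firstVec]
    push_cast
    rw [firstCoeff]
    module
  · rw [firstVec, add_assoc, add_sub_cancel_left]
    exact Submodule.add_mem _ (Submodule.smul_mem _ _ m2) (Submodule.smul_mem _ _ m3)
  · rw [lastVec, add_right_comm, add_sub_cancel_right]
    exact Submodule.add_mem _ (Submodule.smul_mem _ _ m1) (Submodule.smul_mem _ _ m2)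

theorem lastCoeff_right_ne_zero (h : IsFramedCycle r e A Q B) (k : ℕ) :
    (lastCoeff A Q B k).2.2 ≠ 0 := by
  induction k with
  | zero => exact h.right_ne_zero _
  | succ k ih => exact mul_ne_zero (h.right_ne_zero _) ih

/-- A zero can enter the outer coefficients, here and in `firstCoeff`, only through an earlier
middle coefficient of `lastCoeff`. -/
theorem lastCoeff_left_ne_zero (h : IsFramedCycle r e A Q B) {k : ℕ}
    (hq : ∀ j < k, (lastCoeff A Q B j).2.1 ≠ 0) : (lastCoeff A Q B k).1 ≠ 0 := by
  cases k with
  | zero => exact h.left_ne_zero _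
  | succ k => exact mul_ne_zero (neg_ne_zero.2 (hq k (by omega))) (h.left_ne_zero _)

theorem firstCoeff_left_ne_zero (h : IsFramedCycle r e A Q B) {k : ℕ}
    (hq : ∀ j < k, (lastCoeff A Q B j).2.1 ≠ 0) : (firstCoeff A Q B k).1 ≠ 0 := by
  induction k with
  | zero => exact h.left_ne_zero _
  | succ k ih =>
    exact mul_ne_zero (ih fun j hj => hq j (by omega))
      (h.lastCoeff_left_ne_zero fun j hj => hq j (by omega))

theorem firstCoeff_right_ne_zero (h : IsFramedCycle r e A Q B) {k : ℕ}
    (hq : ∀ j < k, (lastCoeff A Q B j).2.1 ≠ 0) : (firstCoeff A Q B k).2.2 ≠ 0 := by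
  induction k with
  | zero => exact h.right_ne_zero _
  | succ k ih =>
    exact mul_ne_zero (neg_ne_zero.2 (hq k (by omega))) (ih fun j hj => hq j (by omega))

theorem firstBoundary_eq (h : IsFramedCycle r e A Q B) {k : ℕ} (hk : k ≤ n - 3)
    (hq : ∀ j < k, (lastCoeff A Q B j).2.1 ≠ 0) :
    firstBoundary r e k = Submodule.span ℝ {firstVec r A Q B k} := by
  induction k with
  | zero =>
    rw [firstBoundary, pt_eq, h.eq, firstVec]
    norm_num [firstCoeff]
  | succ k ih =>
    exact h.firstBoundary_succ_eq hk (ih (by omega) fun j hj => hq j (by omega))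
      (Or.inr (hq k (by omega)))

end IsFramedCycle

/-- The factor formed by the middle coefficients is the same as in `prod_right`. This is what
removes `Q` from the final criterion. -/
theorem prod_left (A Q B : ZMod n → ℝ) (k : ℕ) :
    (firstCoeff A Q B k).1 * (lastCoeff A Q B k).1 =
      A 1 * A 0 * ((∏ j ∈ Finset.range k, -(lastCoeff A Q B j).2.1) *
        ∏ j ∈ Finset.range k, A (-(j + 1))) := by
  induction k with
  | zero => simp [firstCoeff, lastCoeff]
  | succ k ih =>
    rw [Finset.prod_range_succ, Finset.prod_range_succ, firstCoeff, ih, lastCoeff]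
    ring

theorem prod_right (A Q B : ZMod n → ℝ) (k : ℕ) :
    (firstCoeff A Q B k).2.2 * (lastCoeff A Q B k).2.2 =
      B 1 * B 0 * ((∏ j ∈ Finset.range k, -(lastCoeff A Q B j).2.1) *
        ∏ j ∈ Finset.range k, B (-(j + 1))) := by
  induction k with
  | zero => simp [firstCoeff, lastCoeff]
  | succ k ih =>
    have : (firstCoeff A Q B (k + 1)).2.2 * (lastCoeff A Q B (k + 1)).2.2 =
        -(lastCoeff A Q B k).2.1 * B (-(k + 1)) *
          ((firstCoeff A Q B k).2.2 * (lastCoeff A Q B k).2.2) := by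
      simp only [firstCoeff, lastCoeff]; ring
    rw [Finset.prod_range_succ, Finset.prod_range_succ, this, ih]
    ring

end Recursion

/-! ### The condition as an equality of products -/

section Condition

variable {d n : ℕ} {r e : ZMod n → EuclideanSpace ℝ (Fin d)} {A Q B : ZMod n → ℝ}

namespace IsFramedCycle

theorem natCast_sub_three (h : IsFramedCycle r e A Q B) : ((n - 3 : ℕ) : ZMod n) = -3 := by
  rw [Nat.cast_sub h.three_le]; simp

theorem lastVec_ne_zero (h : IsFramedCycle r e A Q B) {k : ℕ} (hk : k ≤ n - 3) :
    lastVec r A Q B k ≠ 0 := by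
  intro h0
  refine h.lastCoeff_right_ne_zero k ?_
  rw [lastVec] at h0
  rcases hk.lt_or_eq with hk | rfl
  · refine (coeff_eq_zero_of_four (h.independent_four _ _ _ _ (h.injective_last hk)) (a := 0)
      (b := (lastCoeff A Q B k).1) (d := (lastCoeff A Q B k).2.1) ?_).2.2.1
    rw [← h0]; module
  -- At the last stage the indices are 2, 3, 1: only three points remain, and for `n = 3` there is
  -- no fourth one.
  · rw [h.natCast_sub_three] at h0
    norm_num at h0
    refine (coeff_eq_zero_of_three h.independent_three (b := (lastCoeff A Q B (n - 3)).1)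
      (c := (lastCoeff A Q B (n - 3)).2.1) ?_).1
    rw [← h0]; module

theorem firstVec_ne_zero (h : IsFramedCycle r e A Q B) {k : ℕ} (hk : k ≤ n - 3)
    (hq : ∀ j < k, (lastCoeff A Q B j).2.1 ≠ 0) : firstVec r A Q B k ≠ 0 := by
  intro h0
  refine h.firstCoeff_right_ne_zero hq ?_
  rw [firstVec] at h0
  rcases hk.lt_or_eq with hk | rfl
  · refine (coeff_eq_zero_of_four (h.independent_four _ _ _ _ (h.injective_first hk)) (a := 0)
      (b := (firstCoeff A Q B k).2.1) (d := (firstCoeff A Q B k).1) ?_).2.2.1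
    rw [← h0]; module
  · rw [h.natCast_sub_three] at h0
    norm_num at h0
    refine (coeff_eq_zero_of_three h.independent_three (a := (firstCoeff A Q B (n - 3)).2.1)
      (c := (firstCoeff A Q B (n - 3)).1) ?_).2.1
    rw [← h0]; module

theorem recursionDefined (h : IsFramedCycle r e A Q B)
    (hq : ∀ j < n - 3, (lastCoeff A Q B j).2.1 ≠ 0) : RecursionDefined r e := by
  intro k hk
  have hq' : ∀ j < k, (lastCoeff A Q B j).2.1 ≠ 0 := fun j hj => hq j (by omega)
  rw [h.firstBoundary_eq hk hq', h.lastBoundary_eq hk]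
  exact ⟨finrank_span_singleton (h.firstVec_ne_zero hk hq'),
    finrank_span_singleton (h.lastVec_ne_zero hk)⟩

theorem homVec_two_eq (h : IsFramedCycle r e A Q B) :
    homVec (e 2) = A 2 • homVec (r 1) + Q 2 • homVec (r 2) + B 2 • homVec (r 3) := by
  have h1 : (2 : ZMod n) - 1 = 1 := by norm_num
  have h2 : (2 : ZMod n) + 1 = 3 := by norm_num
  rw [h.eq, h1, h2]

/-- Assuming only the formula `hF` lets this serve the degenerate case too, where a middle
coefficient vanishes. -/
theorem joinIntersectionCondition_iff_exists (hd : 3 ≤ d) (h : IsFramedCycle r e A Q B)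
    (hF : firstBoundary r e (n - 3) = Submodule.span ℝ {firstVec r A Q B (n - 3)}) :
    JoinIntersectionCondition r e ↔ ∃ x ≠ 0,
      (∃ s t : ℝ, s • homVec (r 1) + t • ((firstCoeff A Q B (n - 3)).1 • homVec (r 3) +
        (firstCoeff A Q B (n - 3)).2.1 • homVec (r 1) +
        (firstCoeff A Q B (n - 3)).2.2 • homVec (r 2)) = x) ∧
      (∃ s t : ℝ, s • homVec (r 2) +
        t • (A 2 • homVec (r 1) + Q 2 • homVec (r 2) + B 2 • homVec (r 3)) = x) ∧
      (∃ s t : ℝ, s • homVec (r 3) + t • ((lastCoeff A Q B (n - 3)).1 • homVec (r 2) +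
        (lastCoeff A Q B (n - 3)).2.1 • homVec (r 3) +
        (lastCoeff A Q B (n - 3)).2.2 • homVec (r 1)) = x) := by
  have e1 : -((n - 3 : ℕ) : ZMod n) = 3 := by rw [h.natCast_sub_three, neg_neg]
  have e2 : -(((n - 3 : ℕ) : ZMod n) + 1) = 2 := by rw [h.natCast_sub_three]; norm_num
  rw [JoinIntersectionCondition, hF, h.lastBoundary_eq le_rfl, meetIsTrue_iff hd]
  · simp only [Matrix.cons_val_zero, Matrix.cons_val_one, Matrix.cons_val, pt_eq,
      mem_span_sup_span_iff, h.homVec_two_eq, firstVec, lastVec, e1, e2]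
  · exact finrank_span_sup_span_le _ _
  · exact finrank_span_sup_span_le _ _

/-- Ceva's theorem for the triangle that is left at the end of the recursion. -/
theorem joinIntersectionCondition_iff_mul_eq (hd : 3 ≤ d) (h : IsFramedCycle r e A Q B)
    (hq : ∀ j < n - 3, (lastCoeff A Q B j).2.1 ≠ 0) :
    JoinIntersectionCondition r e ↔
      (firstCoeff A Q B (n - 3)).1 * A 2 * (lastCoeff A Q B (n - 3)).1 =
        (firstCoeff A Q B (n - 3)).2.2 * B 2 * (lastCoeff A Q B (n - 3)).2.2 := by
  rw [h.joinIntersectionCondition_iff_exists hd (h.firstBoundary_eq le_rfl hq)]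
  have ha := h.lastCoeff_left_ne_zero hq
  have hb := h.lastCoeff_right_ne_zero (n - 3)
  have hx := h.firstCoeff_left_ne_zero hq
  have hz := h.firstCoeff_right_ne_zero hq
  have hA := h.left_ne_zero 2
  have hB := h.right_ne_zero 2
  generalize (firstCoeff A Q B (n - 3)).1 = x at *
  generalize (firstCoeff A Q B (n - 3)).2.1 = y at *
  generalize (firstCoeff A Q B (n - 3)).2.2 = z at *
  generalize (lastCoeff A Q B (n - 3)).1 = a at *
  generalize (lastCoeff A Q B (n - 3)).2.1 = q at *
  generalize (lastCoeff A Q B (n - 3)).2.2 = b at *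
  constructor
  · rintro ⟨w, hw, ⟨s₁, t₁, h₁⟩, ⟨s₂, t₂, h₂⟩, ⟨s₃, t₃, h₃⟩⟩
    obtain ⟨u1, u2, u3⟩ := coeff_eq_zero_of_three h.independent_three
      (a := s₁ + t₁ * y - t₂ * A 2) (b := t₁ * z - s₂ - t₂ * Q 2) (c := t₁ * x - t₂ * B 2) (by
        rw [← sub_eq_zero.2 (h₁.trans h₂.symm)]; module)
    obtain ⟨v1, v2, v3⟩ := coeff_eq_zero_of_three h.independent_three
      (a := t₂ * A 2 - t₃ * b) (b := s₂ + t₂ * Q 2 - t₃ * a) (c := t₂ * B 2 - s₃ - t₃ * q) (by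
        rw [← sub_eq_zero.2 (h₂.trans h₃.symm)]; module)
    have ht₂ : t₂ ≠ 0 := by
      rintro rfl
      have : t₃ = 0 := by simpa [hb] using v1
      have : s₂ = 0 := by simpa [this] using v2
      exact hw (by rw [← h₂, this]; simp)
    have ht₃ : t₃ ≠ 0 := by
      rintro rfl
      simp [ht₂, hA] at v1
    have ht₁ : t₁ ≠ 0 := by
      rintro rfl
      simp [ht₂, hB] at u3
    refine mul_left_cancel₀ (mul_ne_zero (mul_ne_zero ht₁ ht₂) ht₃) ?_
    have k1 : t₁ * x = t₂ * B 2 := by linarith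
    have k2 : t₂ * A 2 = t₃ * b := by linarith
    have k3 : t₃ * a = t₁ * z := by linarith
    calc t₁ * t₂ * t₃ * (x * A 2 * a) = (t₁ * x) * (t₂ * A 2) * (t₃ * a) := by ring
      _ = (t₂ * B 2) * (t₃ * b) * (t₁ * z) := by rw [k1, k2, k3]
      _ = _ := by ring
  · intro heq
    -- The intersection of the lines through `r₂` and `r₃`; `heq` puts it on the line through `r₁`.
    refine ⟨(A 2 * b) • homVec (r 1) + (A 2 * a) • homVec (r 2) + (B 2 * b) • homVec (r 3), ?_,
      ⟨A 2 * b - A 2 * a / z * y, A 2 * a / z, ?_⟩, ⟨A 2 * a - b * Q 2, b, ?_⟩,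
      ⟨B 2 * b - A 2 * q, A 2, ?_⟩⟩
    · intro h0
      exact mul_ne_zero hA hb (coeff_eq_zero_of_three h.independent_three h0).1
    · have : A 2 * a / z * x = B 2 * b := by field_simp; linarith
      match_scalars
      · ring
      · linarith
      · field_simp
    · module
    · module

/-- The first vanishing of the middle coefficient either makes the recursion undefined or
occurs in the last step, in which case the condition holds. -/
theorem joinIntersectionCondition_of_eq_zero (hd : 3 ≤ d) (h : IsFramedCycle r e A Q B)
    (hrec : RecursionDefined r e) {k : ℕ} (hk : k < n - 3)
    (hq : ∀ j < k, (lastCoeff A Q B j).2.1 ≠ 0) (h0 : (lastCoeff A Q B k).2.1 = 0) :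
    JoinIntersectionCondition r e := by
  have hx := h.firstCoeff_left_ne_zero hq
  have ha := h.lastCoeff_left_ne_zero hq
  have hb := h.lastCoeff_right_ne_zero k
  have hB := h.right_ne_zero (-(k + 1))
  have hF := h.firstBoundary_succ_eq (k := k) hk (h.firstBoundary_eq hk.le hq) (Or.inl hx)
  rcases Nat.lt_or_ge (k + 1) (n - 3) with hlt | hge
  -- Both `e₁^(k+1)` and `e₃^(k+1)` are now the same point of the line `r_{n-k-1} r₁`, off the next
  -- plane, so `e₁^(k+2)` is empty.
  · exfalso
    have hF' := h.firstBoundary_succ_eq (k := k + 1) hlt hF (Or.inr (by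
      simp only [lastCoeff, h0, zero_mul, sub_zero]
      exact mul_ne_zero hB ha))
    have hzero : firstVec r A Q B (k + 1 + 1) = 0 := by
      simp only [firstVec, firstCoeff, lastCoeff, h0]
      match_scalars <;> ring
    have := (hrec (k + 1 + 1) hlt).1
    rw [hF', hzero, IsPoint, Submodule.span_zero_singleton, finrank_bot] at this
    exact zero_ne_one this
  · obtain hN : n - 3 = k + 1 := by omega
    rw [h.joinIntersectionCondition_iff_exists hd (by rw [hN, hF]), hN]
    simp only [firstCoeff, lastCoeff, h0]
    have hA2 := h.left_ne_zero 2
    have hB2 := h.right_ne_zero 2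
    generalize (firstCoeff A Q B k).1 = x at *
    generalize (firstCoeff A Q B k).2.1 = y at *
    generalize (firstCoeff A Q B k).2.2 = z at *
    generalize (lastCoeff A Q B k).1 = a at *
    generalize (lastCoeff A Q B k).2.2 = b at *
    generalize B (-(k + 1)) = c at *
    -- The lines through `r₁` and `r₃` both coincide with `r₁r₃`, and this is where `r₂e₂` meets it.
    refine ⟨A 2 • homVec (r 1) + (0 : ℝ) • homVec (r 2) + B 2 • homVec (r 3), ?_,
      ⟨A 2 - B 2 / a * b, B 2 / (x * a), ?_⟩, ⟨- Q 2, 1, ?_⟩,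
      ⟨B 2 - A 2 / b * a, A 2 / (c * b), ?_⟩⟩
    · intro h0
      exact hA2 (coeff_eq_zero_of_three h.independent_three h0).1
    · match_scalars <;> field_simp <;> ring
    · module
    · match_scalars <;> field_simp <;> ring

theorem mul_eq_iff_prod_eq (h : IsFramedCycle r e A Q B) [NeZero n]
    (hq : ∀ j < n - 3, (lastCoeff A Q B j).2.1 ≠ 0) :
    (firstCoeff A Q B (n - 3)).1 * A 2 * (lastCoeff A Q B (n - 3)).1 =
        (firstCoeff A Q B (n - 3)).2.2 * B 2 * (lastCoeff A Q B (n - 3)).2.2 ↔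
      ∏ i, A i = ∏ i, B i := by
  have hn : n = n - 3 + 3 := by have := h.three_le; omega
  rw [mul_right_comm, mul_right_comm _ (B 2), prod_left, prod_right, prod_zmod_eq _ hn,
    prod_zmod_eq _ hn]
  have hP : ∏ j ∈ Finset.range (n - 3), -(lastCoeff A Q B j).2.1 ≠ 0 :=
    Finset.prod_ne_zero_iff.2 fun j hj => neg_ne_zero.2 (hq j (Finset.mem_range.1 hj))
  generalize ∏ j ∈ Finset.range (n - 3), -(lastCoeff A Q B j).2.1 = P at *
  rw [← mul_right_inj' hP (c := B 0 * B 1 * B 2 * _)]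
  constructor <;> intro h' <;> linear_combination h'

theorem joinIntersectionCondition_of_prod_eq (hd : 3 ≤ d) (h : IsFramedCycle r e A Q B)
    [NeZero n] (hrec : RecursionDefined r e) (hprod : ∏ i, A i = ∏ i, B i) :
    JoinIntersectionCondition r e := by
  classical
  by_cases hq : ∀ j < n - 3, (lastCoeff A Q B j).2.1 ≠ 0
  · rwa [h.joinIntersectionCondition_iff_mul_eq hd hq, h.mul_eq_iff_prod_eq hq]
  · have hq' : ∃ j, j < n - 3 ∧ (lastCoeff A Q B j).2.1 = 0 := by simpa using hq
    obtain ⟨hlt, h0⟩ := Nat.find_spec hq'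
    exact h.joinIntersectionCondition_of_eq_zero hd hrec hlt
      (fun j hj h0' => Nat.find_min hq' hj ⟨by omega, h0'⟩) h0

theorem prod_eq_of_joinIntersectionCondition (hd : 3 ≤ d) (h : IsFramedCycle r e A Q B)
    [NeZero n] (hq : ∀ j < n - 3, (lastCoeff A Q B j).2.1 ≠ 0)
    (hcond : JoinIntersectionCondition r e) : ∏ i, A i = ∏ i, B i := by
  rwa [h.joinIntersectionCondition_iff_mul_eq hd hq, h.mul_eq_iff_prod_eq hq] at hcond

end IsFramedCycle

end Condition

/-! ### Holonomy along a cycle of the framework -/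

section CycleLemmas

variable {V : Type*} {d n : ℕ} {G : SimpleGraph V} {c : ZMod n → V}

namespace IsCycleIn

theorem adj_sub (hc : IsCycleIn G c) (i : ZMod n) : G.Adj (c i) (c (i - 1)) := by
  have := hc.adj (i - 1)
  rw [sub_add_cancel] at this
  exact this.symm

theorem sub_ne_add (hc : IsCycleIn G c) (i : ZMod n) : c (i - 1) ≠ c (i + 1) := by
  intro h
  have h1 : i - 1 = i + 1 := hc.injective h
  have h2 : ((2 : ℕ) : ZMod n) = 0 := by
    push_cast
    linear_combination -h1
  rw [ZMod.natCast_eq_zero_iff] at h2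
  have := Nat.le_of_dvd (by norm_num) h2
  have := hc.three_le
  omega

theorem neZero (hc : IsCycleIn G c) : NeZero n :=
  ⟨by have := hc.three_le; omega⟩

end IsCycleIn

theorem prod_left_eq_prod_right_reverse [NeZero n] (f : V → V → ℝ) :
    ∏ i, f (c i) (c (i - 1)) = ∏ i, f (c (i + 1)) (c i) := by
  rw [← Equiv.prod_comp (Equiv.addRight (1 : ZMod n)) fun i => f (c i) (c (i - 1))]
  simp

theorem linearIndependent_homVec {ι : Type*} [Fintype ι] {q : ι → EuclideanSpace ℝ (Fin d)}
    (hq : AffineIndependent ℝ q) : LinearIndependent ℝ fun j => homVec (q j) := by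
  rw [Fintype.linearIndependent_iff]
  intro g hg i
  have h1 := congrArg Prod.fst hg
  have h2 := congrArg Prod.snd hg
  simp only [homVec, Prod.fst_sum, Prod.snd_sum, Prod.smul_fst, Prod.smul_snd, Prod.fst_zero,
    Prod.snd_zero, smul_eq_mul, mul_one] at h1 h2
  exact affineIndependent_iff.1 hq Finset.univ g h1 h2 i (Finset.mem_univ i)

variable [Fintype V] [DecidableRel G.Adj] {p : V → EuclideanSpace ℝ (Fin d)}

theorem InThreeDGeneralPosition.independent_four (hp : InThreeDGeneralPosition G p)
    (hc : IsCycleIn G c) (i j k l : ZMod n) (h : Function.Injective ![i, j, k, l]) :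
    LinearIndependent ℝ
      ![homVec (p (c i)), homVec (p (c j)), homVec (p (c k)), homVec (p (c l))] := by
  have h1 := hp.2 n c hc _ h
  rw [direction_affineSpan] at h1
  have h2 := linearIndependent_homVec
    ((affineIndependent_iff_finrank_vectorSpan_eq ℝ _ (by simp)).2 h1)
  convert h2 using 1
  funext a
  fin_cases a <;> rfl

/-- Two consecutive edges of a cycle are not collinear if the cycle can be framed. -/
theorem InThreeDGeneralPosition.independent_three (hp : InThreeDGeneralPosition G p)
    (hc : IsCycleIn G c) {i : ZMod n}
    (hi : ∃ u, G.Adj (c i) u ∧ u ≠ c (i - 1) ∧ u ≠ c (i + 1)) :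
    LinearIndependent ℝ ![homVec (p (c (i - 1))), homVec (p (c i)), homVec (p (c (i + 1)))] := by
  obtain ⟨u, hu, hu1, hu2⟩ := hi
  rw [Fintype.linearIndependent_iff]
  intro g hg
  have h1 := congrArg Prod.fst hg
  have h2 := congrArg Prod.snd hg
  simp [homVec, Fin.sum_univ_succ] at h1 h2
  have h0 := hp.1.pair_independent (hc.adj_sub i) (hc.adj i) (hc.sub_ne_add i) hu hu1 hu2
    (s := g 0) (t := g 2) (by
      rw [← h2, eq_neg_of_add_eq_zero_left (a := g 1) (b := g 0 + g 2) (by linarith)]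
      module)
  intro a
  fin_cases a
  · exact h0.1
  · have := h0.1; have := h0.2
    simp only [Fin.isValue, Fin.mk_one]
    linarith
  · exact h0.2

/-- A framing of a cycle, given by multiples of the relations at the vertices. -/
theorem InThreeDGeneralPosition.isFramedCycle (hp : InThreeDGeneralPosition G p)
    (hc : IsCycleIn G c) (hthird : ∃ u, G.Adj (c 2) u ∧ u ≠ c (2 - 1) ∧ u ≠ c (2 + 1))
    {lam : V → V → ℝ} (hlam : ∀ u v, G.Adj u v → lam u v ≠ 0) {t : ZMod n → ℝ}
    (ht : ∀ i, t i ≠ 0) {e : ZMod n → EuclideanSpace ℝ (Fin d)}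
    (he : ∀ i, e i - p (c i) = (t i * lam (c i) (c (i - 1))) • (p (c (i - 1)) - p (c i)) +
      (t i * lam (c i) (c (i + 1))) • (p (c (i + 1)) - p (c i))) :
    IsFramedCycle (fun i => p (c i)) e (fun i => t i * lam (c i) (c (i - 1)))
      (fun i => 1 - t i * lam (c i) (c (i - 1)) - t i * lam (c i) (c (i + 1)))
      (fun i => t i * lam (c i) (c (i + 1))) where
  three_le := hc.three_le
  eq i := by
    ext1
    · simp only [homVec, Prod.fst_add, Prod.smul_fst, smul_eq_mul]
      ring
    · simp only [homVec, Prod.snd_add, Prod.smul_snd]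
      rw [eq_add_of_sub_eq (he i)]
      module
  left_ne_zero i := mul_ne_zero (ht i) (hlam _ _ (hc.adj_sub i))
  right_ne_zero i := mul_ne_zero (ht i) (hlam _ _ (hc.adj i))
  independent_three := by
    have h1 : (2 : ZMod n) - 1 = 1 := by norm_num
    have h2 : (2 : ZMod n) + 1 = 3 := by norm_num
    have := hp.independent_three hc hthird
    rwa [h1, h2] at this
  independent_four := hp.independent_four hc

/-- If the relations at the vertices have trivial holonomy along a cycle, the join/intersection
conditions hold along this cycle. -/
theorem InThreeDGeneralPosition.condition_of_prod_eq (hd : 3 ≤ d)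
    (hp : InThreeDGeneralPosition G p) (hc : IsCycleIn G c) [NeZero n] {lam : V → V → ℝ}
    (hlam : ∀ u v, G.Adj u v → lam u v ≠ 0)
    (hrel : ∀ v, 1 < G.degree v → ∑ u ∈ G.neighborFinset v, lam v u • (p u - p v) = 0)
    (hprod : ∏ i, lam (c i) (c (i - 1)) = ∏ i, lam (c i) (c (i + 1)))
    {e : ZMod n → EuclideanSpace ℝ (Fin d)} (he : IsAssociatedFraming G p c e)
    (hrec : RecursionDefined (fun i => p (c i)) e) :
    JoinIntersectionCondition (fun i => p (c i)) e := by
  have key := fun i => hp.1.exists_of_mem_inter (hc.adj_sub i) (hc.adj i) (hc.sub_ne_add i)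
    (hlam (c i)) (hrel _ (one_lt_degree_of_adj (hc.adj_sub i) (hc.adj i) (hc.sub_ne_add i)))
    (he i).1 (he i).2.1 (he i).2.2
  choose t ht hte using fun i => (key i).1
  refine (hp.isFramedCycle hc (key 2).2 hlam ht hte).joinIntersectionCondition_of_prod_eq hd
    hrec ?_
  rw [Finset.prod_mul_distrib, Finset.prod_mul_distrib, hprod]

theorem continuous_lastCoeff (x y : ZMod n → ℝ) (k : ℕ) :
    Continuous fun t : ℝ => lastCoeff (fun i => t * x i) (fun i => 1 - t * x i - t * y i)
      (fun i => t * y i) k := by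
  induction k with
  | zero => simp only [lastCoeff]; fun_prop
  | succ k ih => simp only [lastCoeff]; fun_prop

/-- At `t = 0` the boundary points collapse to the vertices: `A = B = 0` and `Q = 1`. -/
theorem lastCoeff_zero (x y : ZMod n → ℝ) (k : ℕ) :
    (lastCoeff (fun i => 0 * x i) (fun i => 1 - 0 * x i - 0 * y i) (fun i => 0 * y i) k).2.1 =
      (-1) ^ k := by
  induction k with
  | zero => simp [lastCoeff]
  | succ k ih =>
    simp only [lastCoeff, ih]
    ring

/-- The boundary points can be chosen in such a way that the recursion does not degenerate. -/
theorem exists_lastCoeff_ne_zero (x y : ZMod n → ℝ) (m : ℕ) :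
    ∃ t : ℝ, t ≠ 0 ∧ ∀ k < m, (lastCoeff (fun i => t * x i) (fun i => 1 - t * x i - t * y i)
      (fun i => t * y i) k).2.1 ≠ 0 := by
  have h : ∀ᶠ t : ℝ in nhdsWithin 0 {0}ᶜ, ∀ k ∈ Finset.range m,
      (lastCoeff (fun i => t * x i) (fun i => 1 - t * x i - t * y i)
        (fun i => t * y i) k).2.1 ≠ 0 := by
    rw [Filter.eventually_all_finset]
    intro k _
    refine Filter.Eventually.filter_mono nhdsWithin_le_nhds ?_
    refine ((continuous_lastCoeff x y k).snd.fst.tendsto 0).eventually_ne ?_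
    rw [lastCoeff_zero]
    exact pow_ne_zero _ (by norm_num)
  obtain ⟨t, h1, h2⟩ := (h.and self_mem_nhdsWithin).exists
  exact ⟨t, h2, fun k hk => h1 k (Finset.mem_range.2 hk)⟩

theorem InThreeDGeneralPosition.prod_eq_of_condition (hd : 3 ≤ d)
    (hp : InThreeDGeneralPosition G p) (hc : IsCycleIn G c) [NeZero n] {lam : V → V → ℝ}
    (hlam : ∀ u v, G.Adj u v → lam u v ≠ 0)
    (hrel : ∀ v, 1 < G.degree v → ∑ u ∈ G.neighborFinset v, lam v u • (p u - p v) = 0)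
    (hthird : ∀ i, ∃ u, G.Adj (c i) u ∧ u ≠ c (i - 1) ∧ u ≠ c (i + 1))
    (hcond : ∀ e, IsAssociatedFraming G p c e → RecursionDefined (fun i => p (c i)) e →
      JoinIntersectionCondition (fun i => p (c i)) e) :
    ∏ i, lam (c i) (c (i - 1)) = ∏ i, lam (c i) (c (i + 1)) := by
  obtain ⟨t, ht, hq⟩ := exists_lastCoeff_ne_zero (fun i => lam (c i) (c (i - 1)))
    (fun i => lam (c i) (c (i + 1))) (n - 3)
  set e : ZMod n → EuclideanSpace ℝ (Fin d) := fun i =>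
    (t * lam (c i) (c (i - 1))) • (p (c (i - 1)) - p (c i)) +
      (t * lam (c i) (c (i + 1))) • (p (c (i + 1)) - p (c i)) + p (c i) with he
  have hsub : ∀ i, e i - p (c i) = (t * lam (c i) (c (i - 1))) • (p (c (i - 1)) - p (c i)) +
      (t * lam (c i) (c (i + 1))) • (p (c (i + 1)) - p (c i)) := fun i => add_sub_cancel_right _ _
  have hF := hp.isFramedCycle hc (hthird 2) hlam (t := fun _ => t) (fun _ => ht) hsub
  have hframing : IsAssociatedFraming G p c e := by
    intro i
    have hdeg := one_lt_degree_of_adj (hc.adj_sub i) (hc.adj i) (hc.sub_ne_add i)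
    obtain ⟨h1, h2⟩ := mem_starSpan_of_relation (hc.adj_sub i) (hc.adj i) (hc.sub_ne_add i)
      (hrel _ hdeg) (hsub i)
    refine ⟨h1, h2, fun h0 => ?_⟩
    rw [← sub_eq_zero, hsub] at h0
    obtain ⟨u, hu, hu1, hu2⟩ := hthird i
    exact mul_ne_zero ht (hlam _ _ (hc.adj i)) (hp.1.pair_independent (hc.adj_sub i) (hc.adj i)
      (hc.sub_ne_add i) hu hu1 hu2 h0).2
  have := hF.prod_eq_of_joinIntersectionCondition hd hq
    (hcond e hframing (hF.recursionDefined hq))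
  rw [Finset.prod_mul_distrib, Finset.prod_mul_distrib] at this
  exact mul_left_cancel₀ (Finset.prod_ne_zero_iff.2 fun _ _ => ht) this

/-- At a two-valent vertex of a cycle the relation only involves the edges of the cycle. -/
theorem relation_of_no_third (hc : IsCycleIn G c) {lam : V → V → ℝ}
    (hrel : ∀ v, 1 < G.degree v → ∑ u ∈ G.neighborFinset v, lam v u • (p u - p v) = 0)
    {i : ZMod n} (hi : ¬ ∃ u, G.Adj (c i) u ∧ u ≠ c (i - 1) ∧ u ≠ c (i + 1)) :
    lam (c i) (c (i - 1)) • (p (c (i - 1)) - p (c i)) +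
      lam (c i) (c (i + 1)) • (p (c (i + 1)) - p (c i)) = 0 := by
  classical
  have h := hrel (c i) (one_lt_degree_of_adj (hc.adj_sub i) (hc.adj i) (hc.sub_ne_add i))
  rw [sum_neighborFinset_eq (hc.adj_sub i) (hc.adj i) (hc.sub_ne_add i),
    Finset.filter_eq_empty_iff.2, Finset.sum_empty, add_zero] at h
  · exact h
  · intro u hu hu'
    exact hi ⟨u, by simpa using hu, hu'⟩

theorem homVec_relation {lam mu : ℝ} {x y z : EuclideanSpace ℝ (Fin d)}
    (h : lam • (x - y) + mu • (z - y) = 0) :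
    lam • homVec x + (-lam - mu) • homVec y + mu • homVec z = 0 := by
  ext1
  · simp only [homVec, Prod.fst_add, Prod.smul_fst, Prod.fst_zero, smul_eq_mul]
    ring
  · simp only [homVec, Prod.snd_add, Prod.smul_snd, Prod.snd_zero]
    rw [← h]
    module

/-- A two-valent vertex of a cycle only occurs when the cycle is a degenerate triangle all of
whose vertices are two-valent. -/
theorem InThreeDGeneralPosition.eq_three_of_no_third (hp : InThreeDGeneralPosition G p)
    (hc : IsCycleIn G c) {lam : V → V → ℝ} (hlam : ∀ u v, G.Adj u v → lam u v ≠ 0)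
    (hrel : ∀ v, 1 < G.degree v → ∑ u ∈ G.neighborFinset v, lam v u • (p u - p v) = 0)
    {j : ZMod n} (hj : ¬ ∃ u, G.Adj (c j) u ∧ u ≠ c (j - 1) ∧ u ≠ c (j + 1)) :
    n = 3 ∧ ∀ i, ¬ ∃ u, G.Adj (c i) u ∧ u ≠ c (i - 1) ∧ u ≠ c (i + 1) := by
  have h := homVec_relation (relation_of_no_third hc hrel hj)
  have hne := hlam _ _ (hc.adj j)
  have hne' := hlam _ _ (hc.adj_sub j)
  have hn : n = 3 := by
    by_contra hn
    have hlt := hc.three_le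
    have hinj : Function.Injective ![j - 1, j, j + 1, j + 2] := by
      convert injective_natCast_sub (n := n) (m := ![0, 1, 2, 3]) ?_ ?_ (1 - j) using 1
      · funext a
        fin_cases a <;> simp <;> ring
      · intro a b
        fin_cases a <;> fin_cases b <;> simp
      · intro a
        fin_cases a <;> simp <;> omega
    -- The relation makes three consecutive vertices collinear; a fourth vertex with coefficient 0
    -- contradicts general position.
    have h4 := coeff_eq_zero_of_four (hp.independent_four hc _ _ _ _ hinj) (d := 0)
      ((add_eq_left.2 (zero_smul ℝ _)).trans h)
    exact hne h4.2.2.1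
  refine ⟨hn, fun i hi => ?_⟩
  subst hn
  -- A third edge at `c i` would make the triangle non-degenerate, but the relation at `c j`
  -- involves the same three points.
  have hind := hp.independent_three hc hi
  have hcases : j = i - 1 ∨ j = i ∨ j = i + 1 := by clear * -; revert i j; decide
  have e1 : i - 1 - 1 = i + 1 := by clear * -; revert i; decide
  have e2 : i + 1 + 1 = i - 1 := by clear * -; revert i; decide
  rcases hcases with rfl | rfl | rfl
  · simp only [e1, sub_add_cancel] at h hne hne'
    exact hne' (coeff_eq_zero_of_three hind ((add_rotate _ _ _).symm.trans h)).2.2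
  · exact hne (coeff_eq_zero_of_three hind h).2.2
  · simp only [e2, add_sub_cancel_right] at h hne hne'
    exact hne (coeff_eq_zero_of_three hind ((add_rotate _ _ _).trans h)).1

theorem IsLinearlyGeneric.edge_ne_zero (hp : IsLinearlyGeneric G p) {v a b : V}
    (ha : G.Adj v a) (hb : G.Adj v b) (hab : a ≠ b) : p a - p v ≠ 0 := by
  classical
  intro h
  have := hp.eq_zero_of_relation (one_lt_degree_of_adj ha hb hab) (μ := Pi.single a 1)
    (Finset.sum_eq_zero fun u _ => by
      by_cases hu : u = a
      · rw [hu, h, smul_zero]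
      · rw [Pi.single_eq_of_ne hu, zero_smul]) hb (Pi.single_eq_of_ne hab.symm _) ha
  simp at this

theorem InThreeDGeneralPosition.prod_eq_of_degenerate (hp : InThreeDGeneralPosition G p)
    {c : ZMod 3 → V} (hc : IsCycleIn G c) {lam : V → V → ℝ}
    (hrel : ∀ v, 1 < G.degree v → ∑ u ∈ G.neighborFinset v, lam v u • (p u - p v) = 0)
    (hno : ∀ i, ¬ ∃ u, G.Adj (c i) u ∧ u ≠ c (i - 1) ∧ u ≠ c (i + 1)) :
    ∏ i, lam (c i) (c (i - 1)) = ∏ i, lam (c i) (c (i + 1)) := by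
  have h0 := relation_of_no_third hc hrel (hno 0)
  have h1 := relation_of_no_third hc hrel (hno 1)
  have h2 := relation_of_no_third hc hrel (hno 2)
  have hD := hp.1.edge_ne_zero (hc.adj_sub 0) (hc.adj 0) (hc.sub_ne_add 0)
  rw [prod_zmod_eq 0 rfl, prod_zmod_eq 0 rfl]
  simp only [Finset.range_zero, Finset.prod_empty, mul_one]
  have e1 : (0 : ZMod 3) - 1 = 2 := by decide
  have e2 : (0 : ZMod 3) + 1 = 1 := by decide
  have e3 : (1 : ZMod 3) - 1 = 0 := by decide
  have e4 : (1 : ZMod 3) + 1 = 2 := by decide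
  have e5 : (2 : ZMod 3) - 1 = 1 := by decide
  have e6 : (2 : ZMod 3) + 1 = 0 := by decide
  simp only [e1, e2, e3, e4, e5, e6] at *
  rw [← sub_eq_zero]
  refine (smul_eq_zero_iff_left hD).1 ?_
  generalize lam (c 0) (c 2) = x₀ at *
  generalize lam (c 0) (c 1) = y₀ at *
  generalize lam (c 1) (c 0) = x₁ at *
  generalize lam (c 1) (c 2) = y₁ at *
  generalize lam (c 2) (c 1) = x₂ at *
  generalize lam (c 2) (c 0) = y₂ at *
  -- With these weights the terms along the other two sides cancel, leaving `x₀x₁x₂ - y₀y₁y₂` times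
  -- the edge vector in `hD`.
  linear_combination (norm := module) (x₁ * x₂) • h0 + (y₀ * x₂) • h1 + (y₀ * y₁) • h2

end CycleLemmas

/-! ### Self-stresses as rescaled relations -/

section Main

variable {V : Type*} [Fintype V] {d : ℕ} {G : SimpleGraph V} [DecidableRel G.Adj]
  {p : V → EuclideanSpace ℝ (Fin d)}

theorem sum_smul_sub_eq_zero_iff {w : V → V → ℝ} (hw : ∀ u v, ¬ G.Adj u v → w u v = 0) (v : V) :
    ∑ u, w v u • (p v - p u) = 0 ↔ ∑ u ∈ G.neighborFinset v, w v u • (p u - p v) = 0 := by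
  rw [← neg_eq_zero, ← Finset.sum_neg_distrib,
    ← Finset.sum_subset (Finset.subset_univ (G.neighborFinset v))]
  · simp only [← smul_neg, neg_sub]
  · intro u _ hu
    rw [hw v u (by simpa using hu), zero_smul, neg_zero]

/-- A non-zero self-stress on a connected linearly generic framework does not vanish on any
edge. -/
theorem IsSelfStress.ne_zero (hG : G.Connected) (hp : IsLinearlyGeneric G p) {w : V → V → ℝ}
    (hw : IsSelfStress G p w) (hne : ∃ u v, G.Adj u v ∧ w u v ≠ 0) {u v : V} (h : G.Adj u v) :
    w u v ≠ 0 := by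
  have step : ∀ {v a b}, G.Adj v a → G.Adj v b → w v a ≠ 0 → w v b ≠ 0 := by
    intro v a b ha hb h0 h1
    by_cases hab : a = b
    · exact h0 (hab ▸ h1)
    · have hdeg := one_lt_degree_of_adj ha hb hab
      exact h0 (hp.eq_zero_of_relation hdeg
        ((sum_smul_sub_eq_zero_iff hw.eq_zero v).1 (hw.equilibrium v hdeg)) hb h1 ha)
  have walk : ∀ {a b} (_ : G.Walk a b), (∃ x, G.Adj a x ∧ w a x ≠ 0) →
      ∃ x, G.Adj b x ∧ w b x ≠ 0 := by
    intro a b q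
    induction q with
    | nil => exact id
    | @cons a b _ hab q ih =>
      rintro ⟨x, hx, hx0⟩
      exact ih ⟨a, hab.symm, by rw [hw.symm]; exact step hx hab hx0⟩
  obtain ⟨a, b, hab, h0⟩ := hne
  obtain ⟨x, hx, hx0⟩ := walk (hG.preconnected a u).some ⟨b, hab, h0⟩
  exact step hx h hx0

theorem IsLinearlyGeneric.exists_relations (hp : IsLinearlyGeneric G p) :
    ∃ lam : V → V → ℝ, (∀ u v, G.Adj u v → lam u v ≠ 0) ∧
      ∀ v, 1 < G.degree v → ∑ u ∈ G.neighborFinset v, lam v u • (p u - p v) = 0 := by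
  have : ∀ v, ∃ μ : V → ℝ, (∀ u, G.Adj v u → μ u ≠ 0) ∧
      (1 < G.degree v → ∑ u ∈ G.neighborFinset v, μ u • (p u - p v) = 0) := by
    intro v
    by_cases hv : 1 < G.degree v
    · obtain ⟨μ, h1, h2⟩ := hp.exists_relation hv
      exact ⟨μ, h1, fun _ => h2⟩
    -- Without an equilibrium condition at `v`, any non-zero values will do.
    · exact ⟨1, fun _ _ => one_ne_zero, fun h => absurd h hv⟩
  choose lam h1 h2 using this
  exact ⟨lam, h1, h2⟩

/-- If the relations at the vertices have trivial holonomy, they can be rescaled to a self-stress. -/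
theorem admitsNonzeroTensegrity_of_prod_eq [Nontrivial V] (hG : G.Connected) {lam : V → V → ℝ}
    (hlam : ∀ u v, G.Adj u v → lam u v ≠ 0)
    (hrel : ∀ v, 1 < G.degree v → ∑ u ∈ G.neighborFinset v, lam v u • (p u - p v) = 0)
    (hprod : ∀ (n : ℕ) [NeZero n] (c : ZMod n → V), IsCycleIn G c →
      ∏ i, lam (c i) (c (i - 1)) = ∏ i, lam (c i) (c (i + 1))) :
    AdmitsNonzeroTensegrity G p := by
  obtain ⟨α, hα, hαg⟩ := exists_potential hG (g := fun u v => lam u v / lam v u)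
    (fun u v h => by
      have := hlam u v h
      have := hlam v u h.symm
      field_simp)
    (fun n _ c hc => by
      rw [Finset.prod_div_distrib, ← prod_left_eq_prod_right_reverse, hprod n c hc, div_self]
      exact Finset.prod_ne_zero_iff.2 fun i _ => hlam _ _ (hc.adj i))
  have hadj : ∀ u v, G.Adj u v → α u * lam u v = α v * lam v u := by
    intro u v h
    have := hlam v u h.symm
    rw [hαg u v h]
    field_simp
  have hzero : ∀ u v, ¬ G.Adj u v → (if G.Adj u v then α u * lam u v else 0) = 0 :=
    fun u v h => if_neg h
  refine ⟨fun u v => if G.Adj u v then α u * lam u v else 0, ⟨⟨fun u v => ?_, hzero⟩, ?_⟩, ?_⟩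
  · by_cases h : G.Adj u v
    · simp only [h, h.symm, if_true, hadj u v h]
    · have h' : ¬ G.Adj v u := fun h' => h h'.symm
      simp only [h, h', if_false]
  · intro v hv
    refine (sum_smul_sub_eq_zero_iff hzero v).2 (Eq.trans ?_
      ((congrArg (α v • ·) (hrel v hv)).trans (smul_zero _)))
    simp only [Finset.smul_sum]
    refine Finset.sum_congr rfl fun u hu => ?_
    rw [if_pos (by simpa using hu), mul_smul]
  · obtain ⟨a, b, hab⟩ := exists_pair_ne V
    cases (hG.preconnected a b).some with
    | nil => exact absurd rfl hab
    | @cons _ x _ h _ => exact ⟨a, x, h, by simpa [h] using ⟨hα a, hlam a x h⟩⟩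

end Main

end Tensegrity

open Tensegrity in
theorem theorem4 {V : Type*} [Fintype V] [Nontrivial V] (G : SimpleGraph V) [DecidableRel G.Adj]
    (hG : G.Connected) {d : ℕ} (hd : 3 ≤ d) (p : V → EuclideanSpace ℝ (Fin d))
    (hp : Tensegrity.InThreeDGeneralPosition G p) :
    Tensegrity.AdmitsNonzeroTensegrity G p ↔
      ∀ (n : ℕ) (c : ZMod n → V) (e : ZMod n → EuclideanSpace ℝ (Fin d)),
        Tensegrity.IsCycleIn G c →
        Tensegrity.IsAssociatedFraming G p c e →
        Tensegrity.RecursionDefined (fun i => p (c i)) e →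
        Tensegrity.JoinIntersectionCondition (fun i => p (c i)) e := by
  constructor
  · rintro ⟨w, hw, hne⟩ n c e hc he hrec
    have := hc.neZero
    refine hp.condition_of_prod_eq hd hc (fun u v h => hw.ne_zero hG hp.1 hne h)
      (fun v hv => (sum_smul_sub_eq_zero_iff hw.eq_zero v).1 (hw.equilibrium v hv)) ?_ he hrec
    -- The self-stress itself serves as the family of relations, and its symmetry gives trivial
    -- holonomy.
    rw [prod_left_eq_prod_right_reverse]
    exact Finset.prod_congr rfl fun i _ => hw.symm _ _
  · intro hcond
    obtain ⟨lam, hlam, hrel⟩ := hp.1.exists_relations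
    refine admitsNonzeroTensegrity_of_prod_eq hG hlam hrel fun n _ c hc => ?_
    by_cases hthird : ∀ i, ∃ u, G.Adj (c i) u ∧ u ≠ c (i - 1) ∧ u ≠ c (i + 1)
    · exact hp.prod_eq_of_condition hd hc hlam hrel hthird fun e => hcond n c e hc
    · obtain ⟨j, hj⟩ := not_forall.1 hthird
      obtain ⟨rfl, hno⟩ := hp.eq_three_of_no_third hc hlam hrel hj
      convert hp.prod_eq_of_degenerate hc hrel hno
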